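/- For $k<\omega$ let $\mathfrak E_k$ be the set of points $x^l_i$ ($0\le l\le 2^k$, $i<\omega$) together with a point $x_\infty$. It is ordered by the partial order whose strict relations are exactly: $x^l_{i+1}\le x^{l'}_i$ for $l'\neq l+1$; $x^l_{i+t}\le x^{l'}_i$ for all $l,l'\le 2^k$ and $t\ge 2$; and $x_\infty\le x^l_i$ for all $l\le 2^k$ and $i<\omega$. It carries the topology with subbasis $\{(x^l_i)^\uparrow,\ ((x^l_i)^\uparrow)^c : l\le 2^k,\ i<\omega\}\cup\{\emptyset,(x_\infty)^\uparrow\}$, where $x^\uparrow=\{y: x\le y\}$; this makes $\mathfrak E_k$ an Esakia space. Let $H_k=\mathcal{CU}(\mathfrak E_k)$ be the Heyting algebra of clopen upsets of $\mathfrak E_k$, with meet $\cap$, join $\cup$, $0=\emptyset$, $1=\mathfrak E_k$ and $U\to V=((U\setminus V)^\downarrow)^c$, where $Y^\downarrow=\{x:\exists y\in Y,\ x\le y\}$. For a Heyting algebra $A$ and $G\subseteq A$, let $\langle G\rangle$ denote the smallest subset of $A$ that contains $G$ and is closed under $\wedge,\vee,\to,0,1$. **Proposition.** For every $k<\omega$: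 1. $H_k$ is $(k+1)$-generated: there is $G\subseteq H_k$ with $|G|=k+1$ and $\langle G\rangle=H_k$. 2. $H_k$ contains no infinite $k$-generated subalgebra, i.e. no infinite subalgebra of the form $\langle G\rangle$ with $|G|\le k$. 3. $H_k$ contains, up to isomorphism of Heyting algebras, only finitely many $k$-generated subalgebras, i.e. subalgebras of the form $\langle G\rangle$ with $|G|\le k$. Thus $H_k$ is strictly $(k+1)$-generated: it is infinite, $(k+1)$-generated, and every $G\subseteq H_k$ with $|G|\le k$ generates a finite subalgebra. -/

import Mathlib

/-- An Esakia space: a compact ordered topological space satisfying the Priestley separation axiom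
(if `x ≰ y`, some clopen upset contains `x` and not `y`) in which the downset generated by a clopen
set is clopen. -/
class EsakiaSpace (X : Type*) [TopologicalSpace X] [PartialOrder X] : Prop
    extends CompactSpace X, PriestleySpace X where
  isClopen_lowerClosure : ∀ U : Set X, IsClopen U → IsClopen (lowerClosure U : Set X)

namespace ClopenUpperSet

open TopologicalSpace

variable {X : Type*} [TopologicalSpace X] [PartialOrder X] [EsakiaSpace X]

/-- The implication `U → V := ((U \ V)↓)ᶜ` on clopen upsets. -/
def esakiaImp (U V : ClopenUpperSet X) : ClopenUpperSet X where
  carrier := (lowerClosure ((U : Set X) \ V) : Set X)ᶜ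
  isClopen' := (EsakiaSpace.isClopen_lowerClosure _ (U.isClopen.diff V.isClopen)).compl
  upper' := (lowerClosure ((U : Set X) \ V)).lower.compl

/-- The Heyting algebra of clopen upsets of an Esakia space; meet, join, top and bottom are
intersection, union, the whole space and the empty set. -/
instance instHeytingAlgebra : HeytingAlgebra (ClopenUpperSet X) where
  himp := esakiaImp
  compl U := esakiaImp U ⊥
  le_himp_iff A U V := by
    constructor
    · rintro h x ⟨hxA, hxU⟩
      by_contra hxV
      exact h hxA (subset_lowerClosure ⟨hxU, hxV⟩)
    · rintro h x hxA hx
      obtain ⟨y, ⟨hyU, hyV⟩, hxy⟩ := hx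
      exact hyV (h ⟨A.upper hxy hxA, hyU⟩)
  himp_bot _ := rfl

end ClopenUpperSet

/-- A subalgebra of a Heyting algebra in the signature `∧, ∨, →, 0, 1`. -/
structure HeytingSubalgebra (A : Type*) [HeytingAlgebra A] where
  carrier : Set A
  inf_mem' : ∀ {a b : A}, a ∈ carrier → b ∈ carrier → a ⊓ b ∈ carrier
  sup_mem' : ∀ {a b : A}, a ∈ carrier → b ∈ carrier → a ⊔ b ∈ carrier
  himp_mem' : ∀ {a b : A}, a ∈ carrier → b ∈ carrier → a ⇨ b ∈ carrier
  bot_mem' : ⊥ ∈ carrier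
  top_mem' : ⊤ ∈ carrier

namespace HeytingSubalgebra

variable {A : Type*} [HeytingAlgebra A]

instance instSetLike : SetLike (HeytingSubalgebra A) A where
  coe L := L.carrier
  coe_injective L M h := by cases L; cases M; congr

section Operations

variable (L : HeytingSubalgebra A)

instance instMin : Min L := ⟨fun a b => ⟨a.1 ⊓ b.1, L.inf_mem' a.2 b.2⟩⟩
instance instMax : Max L := ⟨fun a b => ⟨a.1 ⊔ b.1, L.sup_mem' a.2 b.2⟩⟩
instance instHImp : HImp L := ⟨fun a b => ⟨a.1 ⇨ b.1, L.himp_mem' a.2 b.2⟩⟩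
instance instBot : Bot L := ⟨⟨⊥, L.bot_mem'⟩⟩
instance instTop : Top L := ⟨⟨⊤, L.top_mem'⟩⟩
instance instCompl : Compl L := ⟨fun a => a ⇨ ⊥⟩

/-- A subalgebra is a Heyting algebra under the restricted operations. -/
instance instHeytingAlgebra : HeytingAlgebra L :=
  Function.Injective.heytingAlgebra (Subtype.val : L → A) Subtype.val_injective
    Iff.rfl Iff.rfl (fun _ _ => rfl) (fun _ _ => rfl) rfl rfl
    (fun a => himp_bot a.1) (fun _ _ => rfl)

end Operations

/-- `⟨G⟩`, the smallest subalgebra containing `G`. -/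
def closure (G : Set A) : HeytingSubalgebra A where
  carrier := {a | ∀ L : HeytingSubalgebra A, G ⊆ (L : Set A) → a ∈ L}
  inf_mem' ha hb L hL := L.inf_mem' (ha L hL) (hb L hL)
  sup_mem' ha hb L hL := L.sup_mem' (ha L hL) (hb L hL)
  himp_mem' ha hb L hL := L.himp_mem' (ha L hL) (hb L hL)
  bot_mem' L _ := L.bot_mem'
  top_mem' L _ := L.top_mem'

/-- The subalgebra `L` is generated by (at most) `k` elements, that is, by `g₀, …, gₖ₋₁`, possibly
with repetitions. A subalgebra may be finite, so exactly `k` distinct generators are not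
required. -/
def IsGenerated (L : HeytingSubalgebra A) (k : ℕ) : Prop :=
  ∃ G : Set A, G.encard ≤ k ∧ closure G = L

/-- Isomorphism of subalgebras, as Heyting algebras. -/
def IsIsomorphic (L M : HeytingSubalgebra A) : Prop :=
  ∃ f : HeytingHom L M, Function.Bijective f

end HeytingSubalgebra

section Generation

variable (A : Type*) [HeytingAlgebra A]

/-- `A` is `k`-generated: some subset with exactly `k` elements generates `A`. -/
def IsKGenerated (k : ℕ) : Prop :=
  ∃ G : Set A, G.encard = k ∧ (HeytingSubalgebra.closure G : Set A) = Set.univ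

/-- `A` is strongly not `k`-generated: any at most `k` elements generate a finite subalgebra. -/
def IsStronglyNotKGenerated (k : ℕ) : Prop :=
  ∀ G : Set A, G.encard ≤ k → (HeytingSubalgebra.closure G : Set A).Finite

/-- `A` is strictly `k`-generated (used for `k ≥ 1`): it is infinite, `k`-generated and strongly
not `(k - 1)`-generated. -/
def IsStrictlyKGenerated (k : ℕ) : Prop :=
  Infinite A ∧ IsKGenerated A k ∧ IsStronglyNotKGenerated A (k - 1)

end Generation

/-- The points of the space `𝔈ₙ`: `pt l i` is `xˡᵢ` for `l ≤ 2 ^ n`, `i < ω`, and `infty` is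
`x_∞`. -/
inductive LadderSpace (n : ℕ) : Type
  | pt (l : Fin (2 ^ n + 1)) (i : ℕ) : LadderSpace n
  | infty : LadderSpace n

namespace LadderSpace

variable {n : ℕ}

/-- The order of `𝔈ₙ`. -/
inductive Le : LadderSpace n → LadderSpace n → Prop
  | refl (x : LadderSpace n) : Le x x
  | next (l l' : Fin (2 ^ n + 1)) (i : ℕ) (h : (l' : ℕ) ≠ (l : ℕ) + 1) : Le (pt l (i + 1)) (pt l' i)
  | far (l l' : Fin (2 ^ n + 1)) (i t : ℕ) (h : 2 ≤ t) : Le (pt l (i + t)) (pt l' i)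
  | infty (l : Fin (2 ^ n + 1)) (i : ℕ) : Le infty (pt l i)

theorem Le.level {l l' : Fin (2 ^ n + 1)} {i i' : ℕ} (h : Le (pt l i) (pt l' i')) :
    i' < i ∨ (l = l' ∧ i = i') := by
  cases h with
  | refl => exact Or.inr ⟨rfl, rfl⟩
  | next => exact Or.inl (by omega)
  | far => exact Or.inl (by omega)

theorem not_pt_le_infty {l : Fin (2 ^ n + 1)} {i : ℕ} : ¬ Le (pt l i) infty := by
  intro h; cases h

theorem far_le {l l' : Fin (2 ^ n + 1)} {i i' : ℕ} (h : i' + 2 ≤ i) : Le (pt l i) (pt l' i') := by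
  obtain ⟨t, rfl⟩ := Nat.exists_eq_add_of_le (show i' ≤ i by omega)
  exact Le.far l l' i' t (by omega)

theorem infty_le (x : LadderSpace n) : Le infty x := by
  cases x with
  | pt l i => exact Le.infty l i
  | infty => exact Le.refl _

instance instPartialOrder : PartialOrder (LadderSpace n) where
  le := Le
  le_refl := Le.refl
  le_trans x y z hxy hyz := by
    cases x with
    | infty => exact infty_le z
    | pt l i =>
      cases y with
      | infty => exact absurd hxy not_pt_le_infty
      | pt l' i' =>
        cases z with
        | infty => exact absurd hyz not_pt_le_infty
        | pt l'' i'' =>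
          rcases hxy.level with h1 | ⟨rfl, rfl⟩
          · rcases hyz.level with h2 | ⟨rfl, rfl⟩
            · exact far_le (by omega)
            · exact hxy
          · exact hyz
  le_antisymm x y hxy hyx := by
    cases x with
    | infty =>
      cases y with
      | infty => rfl
      | pt l' i' => exact absurd hyx not_pt_le_infty
    | pt l i =>
      cases y with
      | infty => exact absurd hxy not_pt_le_infty
      | pt l' i' =>
        rcases hxy.level with h1 | ⟨rfl, rfl⟩
        · rcases hyx.level with h2 | ⟨rfl, rfl⟩
          · omega
          · rfl
        · rfl

/-- The topology of `𝔈ₙ`, generated by the principal upsets of the points `xˡᵢ`, their complements,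
the empty set and the principal upset of `x_∞`. -/
instance instTopologicalSpace : TopologicalSpace (LadderSpace n) :=
  TopologicalSpace.generateFrom
    ({s | ∃ l i, s = Set.Ici (pt l i)} ∪ {s | ∃ l i, s = (Set.Ici (pt l i))ᶜ} ∪
      {∅, Set.Ici infty})

theorem isClopen_Ici_pt (l : Fin (2 ^ n + 1)) (i : ℕ) : IsClopen (Set.Ici (pt l i)) :=
  ⟨⟨TopologicalSpace.isOpen_generateFrom_of_mem (Or.inl (Or.inr ⟨l, i, rfl⟩))⟩,
    TopologicalSpace.isOpen_generateFrom_of_mem (Or.inl (Or.inl ⟨l, i, rfl⟩))⟩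

theorem finite_levels_le (i : ℕ) :
    {x : LadderSpace n | ∃ l i', i' ≤ i ∧ x = pt l i'}.Finite := by
  refine ((Set.finite_univ (α := Fin (2 ^ n + 1))).prod (Set.finite_Iic i)
    |>.image fun p => pt p.1 p.2).subset ?_
  rintro x ⟨l, i', h, rfl⟩
  exact ⟨(l, i'), ⟨Set.mem_univ _, h⟩, rfl⟩

theorem finite_Ici_pt (l : Fin (2 ^ n + 1)) (i : ℕ) : (Set.Ici (pt l i)).Finite := by
  refine (finite_levels_le i).subset ?_
  intro x hx
  cases x with
  | infty => exact absurd hx not_pt_le_infty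
  | pt l' i' =>
    refine ⟨l', i', ?_, rfl⟩
    rcases Le.level hx with h | ⟨-, h⟩ <;> omega

theorem isOpen_singleton_pt (l : Fin (2 ^ n + 1)) (i : ℕ) :
    IsOpen ({pt l i} : Set (LadderSpace n)) := by
  have key : ({pt l i} : Set (LadderSpace n)) =
      Set.Ici (pt l i) ∩ ⋂ y ∈ Set.Ici (pt l i) \ {pt l i}, (Set.Ici y)ᶜ := by
    ext x
    simp only [Set.mem_singleton_iff, Set.mem_inter_iff, Set.mem_iInter, Set.mem_sdiff,
      Set.mem_compl_iff, Set.mem_Ici]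
    constructor
    · rintro rfl
      exact ⟨le_rfl, fun y hy hyx => hy.2 (le_antisymm hyx hy.1)⟩
    · rintro ⟨hx, h⟩
      by_contra hne
      exact h x ⟨hx, hne⟩ le_rfl
  rw [key]
  refine (isClopen_Ici_pt l i).isOpen.inter
    (((finite_Ici_pt l i).subset Set.sdiff_subset).isOpen_biInter ?_)
  rintro y ⟨hy, -⟩
  cases y with
  | infty => exact absurd hy not_pt_le_infty
  | pt l' i' => exact (isClopen_Ici_pt l' i').compl.isOpen

theorem isOpen_of_infty_notMem {S : Set (LadderSpace n)} (h : infty ∉ S) : IsOpen S := by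
  rw [← Set.biUnion_of_singleton S]
  refine isOpen_biUnion fun x hx => ?_
  cases x with
  | infty => exact absurd hx h
  | pt l i => exact isOpen_singleton_pt l i

theorem finite_compl_of_isOpen {S : Set (LadderSpace n)} (hS : IsOpen S) (h : infty ∈ S) :
    Sᶜ.Finite := by
  induction hS with
  | basic s hs =>
    rcases hs with (⟨l, i, rfl⟩ | ⟨l, i, rfl⟩) | (rfl | rfl)
    · exact absurd h not_pt_le_infty
    · rw [compl_compl]; exact finite_Ici_pt l i
    · exact absurd h (Set.notMem_empty _)
    · refine Set.finite_empty.subset fun x hx => hx (infty_le x)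
  | univ => simp
  | inter s t _ _ hs ht =>
    rw [Set.compl_inter]
    exact (hs h.1).union (ht h.2)
  | sUnion C _ hC =>
    obtain ⟨s, hs, hx⟩ := h
    exact (hC s hs hx).subset (Set.compl_subset_compl.2 (Set.subset_sUnion_of_mem hs))

theorem isClosed_of_finite {S : Set (LadderSpace n)} (hS : S.Finite) : IsClosed S := by
  rw [← Set.biUnion_of_singleton S]
  refine hS.isClosed_biUnion fun x _ => ?_
  cases x with
  | infty => exact ⟨isOpen_of_infty_notMem (by simp)⟩
  | pt l i =>
    have : ({pt l i} : Set (LadderSpace n)) =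
        Set.Ici (pt l i) ∩ (Set.Ici (pt l i) \ {pt l i})ᶜ := by
      ext x
      simp only [Set.mem_singleton_iff, Set.mem_inter_iff, Set.mem_Ici, Set.mem_compl_iff,
        Set.mem_sdiff, not_and, not_not]
      exact ⟨fun hx => ⟨hx.ge, fun _ => hx⟩, fun hx => hx.2 hx.1⟩
    rw [this]
    refine (isClopen_Ici_pt l i).isClosed.inter (IsOpen.isClosed_compl ?_)
    exact isOpen_of_infty_notMem fun hx => absurd hx.1 not_pt_le_infty

instance instEsakiaSpace : EsakiaSpace (LadderSpace n) where
  isCompact_univ := by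
    rw [isCompact_iff_ultrafilter_le_nhds]
    intro f _
    by_cases hf : (f : Filter (LadderSpace n)) ≤ nhds infty
    · exact ⟨infty, Set.mem_univ _, hf⟩
    · obtain ⟨U, hU, hUf⟩ := Filter.not_le.1 hf
      obtain ⟨V, hVU, hV, hx⟩ := mem_nhds_iff.1 hU
      have hVf : Vᶜ ∈ f := Ultrafilter.compl_mem_iff_notMem.2
        fun h => hUf (Filter.mem_of_superset h hVU)
      obtain ⟨x, -, rfl⟩ := Ultrafilter.eq_pure_of_finite_mem (finite_compl_of_isOpen hV hx) hVf
      exact ⟨x, Set.mem_univ _, pure_le_nhds x⟩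
  priestley {x y} hxy := by
    cases x with
    | infty => exact absurd (infty_le y) hxy
    | pt l i => exact ⟨Set.Ici (pt l i), isClopen_Ici_pt l i, isUpperSet_Ici _, le_refl (pt l i), hxy⟩
  isClopen_lowerClosure U hU := by
    by_cases hpt : ∃ l i, pt l i ∈ U
    · obtain ⟨l, i, hi⟩ := hpt
      have hinf : infty ∈ (lowerClosure U : Set (LadderSpace n)) := ⟨pt l i, hi, infty_le _⟩
      have hfin : (lowerClosure U : Set (LadderSpace n))ᶜ.Finite := by
        refine (finite_levels_le (i + 1)).subset fun x hx => ?_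
        cases x with
        | infty => exact absurd hinf hx
        | pt l' i' =>
          refine ⟨l', i', ?_, rfl⟩
          by_contra hlt
          exact hx ⟨pt l i, hi, far_le (by omega)⟩
      refine ⟨⟨isOpen_of_infty_notMem (by simpa using hinf)⟩, ?_⟩
      simpa using (isClosed_of_finite hfin).isOpen_compl
    · by_cases hinf : infty ∈ U
      · exfalso
        have hfin := finite_compl_of_isOpen hU.isOpen hinf
        have hmem : ∀ i : ℕ, (pt 0 i : LadderSpace n) ∈ Uᶜ := fun i hi => hpt ⟨0, i, hi⟩
        exact Set.infinite_of_injective_forall_mem (fun a b h => by simpa using h) hmem hfin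
      · have : U = ∅ := by
          refine Set.eq_empty_of_forall_notMem fun x hx => ?_
          cases x with
          | infty => exact hinf hx
          | pt l i => exact hpt ⟨l, i, hx⟩
        subst this
        simp only [lowerClosure_empty, LowerSet.coe_bot]
        exact isClopen_empty

end LadderSpace

/-- `Hₖ`, the Heyting algebra of clopen upsets of `𝔈ₖ`. -/
abbrev LadderAlgebra (k : ℕ) : Type := ClopenUpperSet (LadderSpace k)

/-! Generation. The `2 ^ n + 1` maximal points are told apart by `n + 1` binary digits, so `n + 1`
sets of maximal points generate their principal upsets. Going down, the upset of `pt l (i + 1)`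
consists of the points not below `pt (l + 1) i`, an implication between sets already built; the last
point of a level is reached by excluding the downsets of the others (`principal_mem_of_zero`). A
clopen upset without `infty` is a finite join of principal upsets, and one with `infty` is `⊤`.

Finiteness. Elements of `closure G` are invariant under the largest bisimulation preserving the
colours given by `G`. If `G` has at most `n` elements, level `i` meets at most `2 ^ m` classes, `m`
being the number of generators that omit some point of level at most `i` (`card_levelClasses_le`).
As `2 ^ m ≤ 2 ^ n`, every level contains two bisimilar points. A point whose only unseen neighbour
one level up has a twin there sees every class, and while `m` is constant this defect spreads
through the ladder, until after about `2 ^ n` levels whole levels collapse into one class. Since `m`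
grows at most `n` times, boundedly many levels, with a bound depending only on `n`, represent all
classes, that of `infty` included. Restriction to these levels embeds the subalgebra in a fixed
finite powerset, which gives both finiteness and finitely many isomorphism types. -/

namespace ClopenUpperSet

variable {X : Type*} [TopologicalSpace X] [PartialOrder X]

theorem mem_sup_iff {U V : ClopenUpperSet X} {x : X} : x ∈ U ⊔ V ↔ x ∈ U ∨ x ∈ V := Iff.rfl

theorem mem_inf_iff {U V : ClopenUpperSet X} {x : X} : x ∈ U ⊓ V ↔ x ∈ U ∧ x ∈ V := Iff.rfl

theorem notMem_bot {x : X} : x ∉ (⊥ : ClopenUpperSet X) := fun h => h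

theorem mem_top {x : X} : x ∈ (⊤ : ClopenUpperSet X) := trivial

theorem mem_of_le {U : ClopenUpperSet X} {x y : X} (hxy : x ≤ y) (hx : x ∈ U) : y ∈ U :=
  U.upper hxy hx

theorem mem_finset_sup_iff {ι : Type*} {s : Finset ι} {f : ι → ClopenUpperSet X} {x : X} :
    x ∈ s.sup f ↔ ∃ i ∈ s, x ∈ f i := by
  classical
  induction s using Finset.induction_on with
  | empty => simpa using notMem_bot
  | insert a s _ ih => simp [Finset.sup_insert, mem_sup_iff, ih]

theorem mem_finset_inf_iff {ι : Type*} {s : Finset ι} {f : ι → ClopenUpperSet X} {x : X} :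
    x ∈ s.inf f ↔ ∀ i ∈ s, x ∈ f i := by
  classical
  induction s using Finset.induction_on with
  | empty => simpa using mem_top
  | insert a s _ ih => simp [Finset.inf_insert, mem_inf_iff, ih]

variable [EsakiaSpace X]

theorem mem_himp_iff {U V : ClopenUpperSet X} {x : X} :
    x ∈ U ⇨ V ↔ ∀ y, x ≤ y → y ∈ U → y ∈ V := by
  change ¬ (∃ y ∈ (U : Set X) \ V, x ≤ y) ↔ _
  constructor
  · intro h y hxy hy
    by_contra hV
    exact h ⟨y, ⟨hy, hV⟩, hxy⟩
  · rintro h ⟨y, ⟨hy, hV⟩, hxy⟩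
    exact hV (h y hxy hy)

end ClopenUpperSet

namespace HeytingSubalgebra

variable {A : Type*} [HeytingAlgebra A]

theorem subset_closure (G : Set A) : G ⊆ (closure G : Set A) := fun _ ha _ hL => hL ha

theorem closure_le {G : Set A} {L : HeytingSubalgebra A} (h : G ⊆ (L : Set A)) :
    (closure G : Set A) ⊆ L := fun _ ha => ha L h

theorem finset_sup_mem (L : HeytingSubalgebra A) {ι : Type*} {s : Finset ι} {f : ι → A}
    (h : ∀ i ∈ s, f i ∈ L) : s.sup f ∈ L :=
  Finset.sup_induction L.bot_mem' (fun _ ha _ hb => L.sup_mem' ha hb) h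

theorem finset_inf_mem (L : HeytingSubalgebra A) {ι : Type*} {s : Finset ι} {f : ι → A}
    (h : ∀ i ∈ s, f i ∈ L) : s.inf f ∈ L :=
  Finset.inf_induction L.top_mem' (fun _ ha _ hb => L.inf_mem' ha hb) h

end HeytingSubalgebra

/-! ### Generation by `n + 1` elements. -/

namespace LadderSpace

open ClopenUpperSet

variable {n : ℕ}

theorem pt_le_pt_iff {l l' : Fin (2 ^ n + 1)} {i i' : ℕ} :
    pt l i ≤ pt l' i' ↔
      (l = l' ∧ i = i') ∨ i' + 2 ≤ i ∨ (i = i' + 1 ∧ (l' : ℕ) ≠ l + 1) := by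
  constructor
  · intro h
    cases h with
    | refl => exact Or.inl ⟨rfl, rfl⟩
    | next _ _ _ h => exact Or.inr (Or.inr ⟨rfl, h⟩)
    | far _ _ _ t h => exact Or.inr (Or.inl (by omega))
  · rintro (⟨rfl, rfl⟩ | h | ⟨rfl, h⟩)
    · exact le_rfl
    · exact far_le h
    · exact Le.next _ _ _ h

/-- All points above level `i`, together with the points of level `i` selected by `s`. -/
def initialSegment (i : ℕ) (s : Fin (2 ^ n + 1) → Prop) : LadderAlgebra n where
  carrier := {x | ∃ l j, x = pt l j ∧ (j < i ∨ (j = i ∧ s l))}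
  isClopen' := by
    refine ⟨isClosed_of_finite ((finite_levels_le i).subset ?_), isOpen_of_infty_notMem ?_⟩
    · rintro x ⟨l, j, rfl, h⟩
      exact ⟨l, j, by omega, rfl⟩
    · rintro ⟨l, j, h, -⟩
      cases h
  upper' := by
    rintro x y hxy ⟨l, j, rfl, h⟩
    cases y with
    | infty => exact absurd hxy not_pt_le_infty
    | pt l' j' =>
      refine ⟨l', j', rfl, ?_⟩
      rcases Le.level hxy with h' | ⟨rfl, rfl⟩
      · exact Or.inl (by omega)
      · exact h

theorem pt_mem_initialSegment {i j : ℕ} {l : Fin (2 ^ n + 1)} {s : Fin (2 ^ n + 1) → Prop} :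
    pt l j ∈ initialSegment i s ↔ j < i ∨ (j = i ∧ s l) := by
  constructor
  · rintro ⟨l', j', h, h'⟩
    cases h
    exact h'
  · exact fun h => ⟨l, j, rfl, h⟩

theorem infty_notMem_initialSegment {i : ℕ} {s : Fin (2 ^ n + 1) → Prop} :
    infty ∉ initialSegment i s := by
  rintro ⟨l, j, h, -⟩
  cases h

/-- The principal upset of `pt l i`. -/
def principal (l : Fin (2 ^ n + 1)) (i : ℕ) : LadderAlgebra n where
  carrier := Set.Ici (pt l i)
  isClopen' := isClopen_Ici_pt l i
  upper' := isUpperSet_Ici _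

theorem mem_principal {l : Fin (2 ^ n + 1)} {i : ℕ} {x : LadderSpace n} :
    x ∈ principal l i ↔ pt l i ≤ x := Iff.rfl

theorem ext_pt {U V : LadderAlgebra n} (h : ∀ l i, pt l i ∈ U ↔ pt l i ∈ V)
    (h' : infty ∈ U ↔ infty ∈ V) : U = V := by
  refine SetLike.ext fun x => ?_
  cases x with
  | infty => exact h'
  | pt l i => exact h l i

theorem mem_of_infty_mem {U : LadderAlgebra n} (h : infty ∈ U) (x : LadderSpace n) : x ∈ U :=
  mem_of_le (infty_le x) h

theorem finite_of_infty_notMem {U : LadderAlgebra n} (h : infty ∉ U) :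
    (U : Set (LadderSpace n)).Finite := by
  simpa using finite_compl_of_isOpen U.isClopen.compl.isOpen h

/-- A clopen upset avoiding `infty` is finite, hence the join of the principal upsets of its points.
-/
theorem mem_of_principal_mem {L : HeytingSubalgebra (LadderAlgebra n)} {U : LadderAlgebra n}
    (h : infty ∉ U) (hL : ∀ l i, pt l i ∈ U → principal l i ∈ L) : U ∈ L := by
  have key : ∀ x : LadderSpace n, x ∈ U → ∃ V ∈ L, V ≤ U ∧ x ∈ V := by
    intro x hx
    cases x with
    | infty => exact absurd hx h
    | pt l i => exact ⟨principal l i, hL l i hx, fun y hy => mem_of_le hy hx, le_refl (pt l i)⟩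
  choose! f hfL hfU hf using key
  have : U = (finite_of_infty_notMem h).toFinset.sup f := by
    refine SetLike.ext fun x => ?_
    rw [mem_finset_sup_iff]
    simp only [Set.Finite.mem_toFinset, SetLike.mem_coe]
    exact ⟨fun hx => ⟨x, hx, hf x hx⟩, fun ⟨y, hy, hxy⟩ => hfU y hy hxy⟩
  rw [this]
  exact L.finset_sup_mem fun x hx => hfL x (by simpa using hx)

/-- The only point of the premise outside the conclusion is `pt (l + 1) i`, so the implication is
the complement of its downset; on level `i + 1` only `pt l (i + 1)` escapes that downset. -/
theorem principal_succ {l : Fin (2 ^ n + 1)} (i : ℕ) (hl : (l : ℕ) + 1 < 2 ^ n + 1) :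
    principal l (i + 1) =
      principal ⟨l + 1, hl⟩ i ⇨ initialSegment i fun m => (m : ℕ) ≠ l + 1 := by
  refine ext_pt (fun m j => ?_) ⟨fun h => absurd h not_pt_le_infty, fun h => ?_⟩
  · rw [mem_himp_iff, mem_principal, pt_le_pt_iff]
    constructor
    · intro h y hy hy'
      cases y with
      | infty => exact absurd hy not_pt_le_infty
      | pt m' j' =>
        rw [mem_principal] at hy'
        rw [pt_mem_initialSegment]
        rw [pt_le_pt_iff] at hy hy'
        simp only [Fin.ext_iff] at *
        omega
    · intro h
      have h1 := h (pt ⟨l + 1, hl⟩ i)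
      have h2 : pt ⟨l + 1, hl⟩ i ∉ initialSegment i fun m => (m : ℕ) ≠ l + 1 := by
        rw [pt_mem_initialSegment]; simp
      have h3 : ¬ pt m j ≤ pt ⟨l + 1, hl⟩ i := fun h' => h2 (h1 h' (le_refl (pt _ i)))
      rw [pt_le_pt_iff] at h3
      simp only [Fin.ext_iff] at *
      omega
  · rw [mem_himp_iff] at h
    have := h (pt ⟨l + 1, hl⟩ i) (infty_le _) (le_refl (pt _ i))
    rw [pt_mem_initialSegment] at this
    simp at this

/-- The last point has no successor index and sees all of level `i`, so it is isolated by excluding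
the downsets of its level-mates. Every point of level `i + 2` lies below the level-mate with index
`0`, since `0` is no successor. -/
theorem principal_last_succ (i : ℕ) :
    principal (Fin.last (2 ^ n)) (i + 1) =
      initialSegment (i + 1) (fun m => m ≠ Fin.last (2 ^ n)) ⇨
        initialSegment (i + 1) (fun _ => False) := by
  have h0 : (0 : Fin (2 ^ n + 1)) ≠ Fin.last (2 ^ n) := by
    rw [ne_eq, Fin.ext_iff, Fin.val_last]
    exact (Nat.two_pow_pos n).ne
  refine ext_pt (fun m j => ?_) ⟨fun h => absurd h not_pt_le_infty, fun h => ?_⟩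
  · rw [mem_himp_iff, mem_principal, pt_le_pt_iff]
    constructor
    · intro h y hy hy'
      cases y with
      | infty => exact absurd hy not_pt_le_infty
      | pt m' j' =>
        rw [pt_mem_initialSegment] at *
        rw [pt_le_pt_iff] at hy
        have hlast := Fin.val_last (2 ^ n)
        simp only [ne_eq, Fin.ext_iff] at *
        omega
    · intro h
      have h1 : ∀ m' : Fin (2 ^ n + 1), m' ≠ Fin.last _ → ¬ pt m j ≤ pt m' (i + 1) := by
        intro m' hm' hle
        have := h _ hle (pt_mem_initialSegment.2 (Or.inr ⟨rfl, hm'⟩))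
        rw [pt_mem_initialSegment] at this
        simp at this
      have h2 := h1 0 h0
      have h3 : m ≠ Fin.last _ → j ≠ i + 1 := by
        rintro hm rfl
        exact h1 m hm le_rfl
      rw [pt_le_pt_iff] at h2
      simp only [ne_eq, Fin.ext_iff] at *
      have hlast := Fin.val_last (2 ^ n)
      have hzero : ((0 : Fin (2 ^ n + 1)) : ℕ) = 0 := rfl
      have := m.2
      omega
  · rw [mem_himp_iff] at h
    have := h (pt 0 (i + 1)) (infty_le _) (pt_mem_initialSegment.2 (Or.inr ⟨rfl, h0⟩))
    rw [pt_mem_initialSegment] at this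
    simp at this

theorem principal_mem_of_zero {L : HeytingSubalgebra (LadderAlgebra n)}
    (h0 : ∀ l, principal l 0 ∈ L) (i : ℕ) : ∀ j ≤ i, ∀ l, principal l j ∈ L := by
  induction i with
  | zero =>
    intro j hj l
    obtain rfl : j = 0 := by omega
    exact h0 l
  | succ i ih =>
    -- These come first: the formula for the last point uses the others of its own level.
    have lower : ∀ l : Fin (2 ^ n + 1), l ≠ Fin.last _ → principal l (i + 1) ∈ L := by
      intro l hl
      have hl' : (l : ℕ) + 1 < 2 ^ n + 1 := by
        have := l.2
        rw [ne_eq, Fin.ext_iff, Fin.val_last] at hl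
        omega
      rw [principal_succ i hl']
      refine L.himp_mem' (ih i le_rfl _) (mem_of_principal_mem infty_notMem_initialSegment ?_)
      intro m j hm
      rw [pt_mem_initialSegment] at hm
      exact ih j (by omega) m
    intro j hj l
    rcases Nat.lt_or_ge j (i + 1) with h | h
    · exact ih j (by omega) l
    obtain rfl : j = i + 1 := by omega
    by_cases hl : l = Fin.last _
    · rw [hl, principal_last_succ]
      refine L.himp_mem' (mem_of_principal_mem infty_notMem_initialSegment ?_)
        (mem_of_principal_mem infty_notMem_initialSegment ?_)
      · intro m j hm
        rw [pt_mem_initialSegment] at hm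
        rcases hm with hm | ⟨rfl, hm⟩
        · exact ih j (by omega) m
        · exact lower m hm
      · intro m j hm
        obtain hm | ⟨-, ⟨⟩⟩ := pt_mem_initialSegment.1 hm
        exact ih j (by omega) m
    · exact lower l hl

/-- The set of maximal points `pt l 0` such that the `j`-th binary digit of `l + 1` is `1`. -/
def digitGenerator (n j : ℕ) : LadderAlgebra n :=
  initialSegment 0 fun l => ((l : ℕ) + 1).testBit j = true

theorem pt_mem_digitGenerator {j i : ℕ} {l : Fin (2 ^ n + 1)} :
    pt l i ∈ digitGenerator n j ↔ i = 0 ∧ ((l : ℕ) + 1).testBit j = true := by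
  simp [digitGenerator, pt_mem_initialSegment]

theorem mem_compl_digitGenerator {j : ℕ} {x : LadderSpace n} :
    x ∈ digitGenerator n j ⇨ ⊥ ↔
      ∀ l : Fin (2 ^ n + 1), x ≤ pt l 0 → ((l : ℕ) + 1).testBit j = false := by
  rw [mem_himp_iff]
  constructor
  · intro h l hl
    by_contra hb
    exact notMem_bot (h _ hl (pt_mem_digitGenerator.2 ⟨rfl, by simpa using hb⟩))
  · intro h y hxy hy
    cases y with
    | infty => exact absurd hy infty_notMem_initialSegment
    | pt l i =>
      obtain ⟨rfl, hb⟩ := pt_mem_digitGenerator.1 hy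
      simp [h l hxy] at hb

/-- The `n + 1` digits determine `l + 1` modulo `2 * 2 ^ n`, and `l ≤ 2 ^ n` is below that modulus.
-/
theorem eq_of_testBit_eq {l m : Fin (2 ^ n + 1)}
    (h : ∀ j ≤ n, ((l : ℕ) + 1).testBit j = ((m : ℕ) + 1).testBit j) : l = m := by
  have hmod : ((l : ℕ) + 1) % 2 ^ (n + 1) = ((m : ℕ) + 1) % 2 ^ (n + 1) := by
    refine Nat.eq_of_testBit_eq fun j => ?_
    rw [Nat.testBit_mod_two_pow, Nat.testBit_mod_two_pow]
    by_cases hj : j < n + 1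
    · simp [hj, h j (by omega)]
    · simp [hj]
  have hp : 1 ≤ 2 ^ n := Nat.one_le_two_pow
  have h1 : 2 ^ (n + 1) = 2 * 2 ^ n := by ring
  rw [h1] at hmod
  ext
  have hl := l.2
  have hm := m.2
  have e : (l : ℕ) ≡ m [MOD 2 * 2 ^ n] := Nat.ModEq.add_right_cancel' 1 hmod
  exact e.eq_of_lt_of_lt (by omega) (by omega)

theorem principal_zero_eq (l : Fin (2 ^ n + 1)) :
    principal l 0 = (Finset.range (n + 1)).inf fun j =>
      if ((l : ℕ) + 1).testBit j = true then digitGenerator n j else digitGenerator n j ⇨ ⊥ := by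
  have hmem : ∀ x : LadderSpace n, x ∈ ((Finset.range (n + 1)).inf fun j =>
      if ((l : ℕ) + 1).testBit j = true then digitGenerator n j else digitGenerator n j ⇨ ⊥) ↔
      ∀ j ≤ n, (((l : ℕ) + 1).testBit j = true → x ∈ digitGenerator n j) ∧
        (((l : ℕ) + 1).testBit j = false → x ∈ digitGenerator n j ⇨ ⊥) := by
    intro x
    rw [mem_finset_inf_iff]
    refine forall_congr' fun j => ?_
    rw [Finset.mem_range, Nat.lt_succ_iff]
    refine imp_congr_right fun _ => ?_
    cases ((l : ℕ) + 1).testBit j <;> simp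
  -- Digit `0` alone rejects non-maximal points. They lie outside every generator, and being below
  -- `pt 0 0`, whose code `1` is odd, outside the pseudocomplement of generator `0` too. This is why
  -- `l + 1` rather than `l` is coded.
  have hlow : ∀ x : LadderSpace n, x ≤ pt 0 0 → (∀ m, x ≠ pt m 0) → ¬ ∀ j ≤ n,
      (((l : ℕ) + 1).testBit j = true → x ∈ digitGenerator n j) ∧
        (((l : ℕ) + 1).testBit j = false → x ∈ digitGenerator n j ⇨ ⊥) := by
    intro x hx hne h
    have h1 : ((l : ℕ) + 1).testBit 0 = true := by
      by_contra hb
      have := mem_compl_digitGenerator.1 ((h 0 (Nat.zero_le _)).2 (by simpa using hb)) 0 hx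
      simp at this
    have h2 := (h 0 (Nat.zero_le _)).1 h1
    cases x with
    | infty => exact infty_notMem_initialSegment h2
    | pt m i => exact hne m (by rw [(pt_mem_digitGenerator.1 h2).1])
  refine ext_pt (fun m i => ?_) ⟨fun h => absurd h not_pt_le_infty, fun h => ?_⟩
  · rw [hmem, mem_principal, pt_le_pt_iff]
    rcases Nat.eq_zero_or_pos i with rfl | hi
    · constructor
      · intro h
        obtain rfl : l = m := by
          rcases h with h | h | h
          · exact h.1
          · omega
          · omega
        refine fun j _ => ⟨fun h => pt_mem_digitGenerator.2 ⟨rfl, h⟩, fun h => ?_⟩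
        rw [mem_compl_digitGenerator]
        intro m hm
        rw [pt_le_pt_iff] at hm
        obtain rfl : l = m := by
          rcases hm with h | h | h
          · exact h.1
          · omega
          · omega
        exact h
      · intro h
        refine Or.inl ⟨eq_of_testBit_eq fun j hj => ?_, rfl⟩
        cases hb : ((l : ℕ) + 1).testBit j with
        | true => exact (pt_mem_digitGenerator.1 ((h j hj).1 hb)).2.symm
        | false => exact (mem_compl_digitGenerator.1 ((h j hj).2 hb) m le_rfl).symm
    · constructor
      · intro h
        omega
      · intro h
        refine absurd h (hlow _ ?_ ?_)
        · rw [pt_le_pt_iff, Fin.val_zero]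
          omega
        · intro m' hm'
          cases hm'
          omega
  · rw [hmem] at h
    exact absurd h (hlow _ (infty_le _) (by simp))

theorem closure_digitGenerator (n : ℕ) :
    (HeytingSubalgebra.closure (digitGenerator n '' Set.Iic n) : Set (LadderAlgebra n)) =
      Set.univ := by
  refine Set.eq_univ_of_forall fun U => ?_
  rw [SetLike.mem_coe]
  set L := HeytingSubalgebra.closure (digitGenerator n '' Set.Iic n)
  have hG : ∀ j ≤ n, digitGenerator n j ∈ L := fun j hj =>
    HeytingSubalgebra.subset_closure _ ⟨j, hj, rfl⟩
  have h0 : ∀ l, principal l 0 ∈ L := by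
    intro l
    rw [principal_zero_eq]
    refine L.finset_inf_mem fun j hj => ?_
    have hj' := hG j (Nat.lt_succ_iff.1 (Finset.mem_range.1 hj))
    split_ifs
    · exact hj'
    · exact L.himp_mem' hj' L.bot_mem'
  by_cases h : infty ∈ U
  · have : U = ⊤ := ext_pt (fun l i => ⟨fun _ => mem_top, fun _ => mem_of_infty_mem h _⟩)
      ⟨fun _ => mem_top, fun _ => h⟩
    rw [this]
    exact L.top_mem'
  · exact mem_of_principal_mem h fun l i _ => principal_mem_of_zero h0 i i le_rfl l

theorem isKGenerated_ladderAlgebra (n : ℕ) : IsKGenerated (LadderAlgebra n) (n + 1) := by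
  refine ⟨digitGenerator n '' Set.Iic n, ?_, closure_digitGenerator n⟩
  rw [Set.InjOn.encard_image]
  · rw [Set.encard_eq_coe_toFinset_card]
    simp
  · intro a ha b hb hab
    -- The maximal point with code `2 ^ a` has `a` as its only nonzero digit, so it separates the
    -- generators.
    have hlt : 2 ^ a - 1 < 2 ^ n + 1 := by
      have : 2 ^ a ≤ 2 ^ n := Nat.pow_le_pow_right (by norm_num) ha
      have hpos := Nat.two_pow_pos n
      omega
    have h1 : pt (⟨2 ^ a - 1, hlt⟩ : Fin (2 ^ n + 1)) 0 ∈ digitGenerator n b := by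
      rw [← hab, pt_mem_digitGenerator]
      simp [Nat.sub_add_cancel Nat.one_le_two_pow]
    rw [pt_mem_digitGenerator] at h1
    have h2 := h1.2
    simp only [Nat.sub_add_cancel Nat.one_le_two_pow, Nat.testBit_two_pow] at h2
    simpa using h2

theorem infinite_ladderAlgebra (n : ℕ) : Infinite (LadderAlgebra n) := by
  refine Infinite.of_injective (fun i : ℕ => (principal (Fin.last _) i : LadderAlgebra n)) ?_
  intro i j h
  have h1 : pt (Fin.last _) i ∈ (principal (Fin.last _) j : LadderAlgebra n) := by
    rw [← show principal _ i = principal _ j from h]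
    exact le_refl (pt _ i)
  have h2 : pt (Fin.last _) j ∈ (principal (Fin.last _) i : LadderAlgebra n) := by
    rw [show principal _ i = principal _ j from h]
    exact le_refl (pt _ j)
  have h3 : (pt (Fin.last (2 ^ n)) i : LadderSpace n) = pt (Fin.last _) j :=
    le_antisymm h2 h1
  cases h3
  rfl

end LadderSpace

/-! ### Bisimulations and invariance of generated subalgebras. -/

section Bisimulation

variable {X : Type*} [TopologicalSpace X] [PartialOrder X]

/-- A symmetric relation is a bisimulation for the colouring given by `G` if related points have the
same colours and every point above one of them is related to a point above the other. -/
structure IsBisimulation (G : Set (ClopenUpperSet X)) (Z : X → X → Prop) : Prop where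
  symm : ∀ {x y}, Z x y → Z y x
  color : ∀ {x y}, Z x y → ∀ g ∈ G, x ∈ g → y ∈ g
  forth : ∀ {x y x'}, Z x y → x ≤ x' → ∃ y', y ≤ y' ∧ Z x' y'

/-- The largest bisimulation for the colouring given by `G`. -/
def Bisimilar (G : Set (ClopenUpperSet X)) (x y : X) : Prop :=
  ∃ Z, IsBisimulation G Z ∧ Z x y

namespace Bisimilar

variable {G : Set (ClopenUpperSet X)} {x y z : X}

theorem refl (x : X) : Bisimilar G x x :=
  ⟨Eq, ⟨Eq.symm, fun h _ _ hx => h ▸ hx, fun h hx => ⟨_, h ▸ hx, rfl⟩⟩, rfl⟩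

theorem symm : Bisimilar G x y → Bisimilar G y x := fun ⟨Z, hZ, h⟩ => ⟨Z, hZ, hZ.symm h⟩

theorem forth {x' : X} : Bisimilar G x y → x ≤ x' → ∃ y', y ≤ y' ∧ Bisimilar G x' y' := by
  rintro ⟨Z, hZ, h⟩ hx
  obtain ⟨y', hy, h'⟩ := hZ.forth h hx
  exact ⟨y', hy, Z, hZ, h'⟩

theorem mem_of_mem {g : ClopenUpperSet X} : Bisimilar G x y → g ∈ G → x ∈ g → y ∈ g :=
  fun ⟨_, hZ, h⟩ hg hx => hZ.color h g hg hx

theorem trans (hxy : Bisimilar G x y) (hyz : Bisimilar G y z) : Bisimilar G x z := by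
  refine ⟨fun a c => ∃ b, Bisimilar G a b ∧ Bisimilar G b c, ⟨?_, ?_, ?_⟩, y, hxy, hyz⟩
  · rintro a c ⟨b, hab, hbc⟩
    exact ⟨b, hbc.symm, hab.symm⟩
  · rintro a c ⟨b, hab, hbc⟩ g hg ha
    exact hbc.mem_of_mem hg (hab.mem_of_mem hg ha)
  · rintro a c a' ⟨b, hab, hbc⟩ ha
    obtain ⟨b', hb, hab'⟩ := hab.forth ha
    obtain ⟨c', hc, hbc'⟩ := hbc.forth hb
    exact ⟨c', hc, b', hab', hbc'⟩

/-- Points of the same colour that see, strictly above them, the same bisimilarity classes are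
bisimilar (either of them may itself serve as a witness). -/
theorem of_lt (hc : ∀ g ∈ G, x ∈ g ↔ y ∈ g)
    (hxy : ∀ x', x < x' → ∃ y', y ≤ y' ∧ Bisimilar G x' y')
    (hyx : ∀ y', y < y' → ∃ x', x ≤ x' ∧ Bisimilar G y' x') : Bisimilar G x y := by
  refine ⟨fun a b => Bisimilar G a b ∨ (a = x ∧ b = y) ∨ (a = y ∧ b = x), ⟨?_, ?_, ?_⟩,
    Or.inr (Or.inl ⟨rfl, rfl⟩)⟩
  · rintro a b (h | ⟨rfl, rfl⟩ | ⟨rfl, rfl⟩)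
    · exact Or.inl h.symm
    · exact Or.inr (Or.inr ⟨rfl, rfl⟩)
    · exact Or.inr (Or.inl ⟨rfl, rfl⟩)
  · rintro a b (h | ⟨rfl, rfl⟩ | ⟨rfl, rfl⟩) g hg ha
    · exact h.mem_of_mem hg ha
    · exact (hc g hg).1 ha
    · exact (hc g hg).2 ha
  · rintro a b a' (h | ⟨rfl, rfl⟩ | ⟨rfl, rfl⟩) ha
    · obtain ⟨b', hb, h'⟩ := h.forth ha
      exact ⟨b', hb, Or.inl h'⟩
    · rcases ha.eq_or_lt with rfl | ha
      · exact ⟨b, le_rfl, Or.inr (Or.inl ⟨rfl, rfl⟩)⟩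
      · obtain ⟨b', hb, h'⟩ := hxy a' ha
        exact ⟨b', hb, Or.inl h'⟩
    · rcases ha.eq_or_lt with rfl | ha
      · exact ⟨b, le_rfl, Or.inr (Or.inr ⟨rfl, rfl⟩)⟩
      · obtain ⟨b', hb, h'⟩ := hyx a' ha
        exact ⟨b', hb, Or.inl h'⟩

variable (G) in
/-- Bisimilarity as a setoid. -/
def setoid : Setoid X := ⟨Bisimilar G, refl, symm, trans⟩

/-- The invariant clopen upsets form a subalgebra containing `G`; the forth condition is what
handles implication. -/
theorem mem_of_mem_closure [EsakiaSpace X] {U : ClopenUpperSet X}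
    (hU : U ∈ HeytingSubalgebra.closure G) (h : Bisimilar G x y) (hx : x ∈ U) : y ∈ U := by
  let S : HeytingSubalgebra (ClopenUpperSet X) :=
    { carrier := {U | ∀ x y, Bisimilar G x y → x ∈ U → y ∈ U}
      inf_mem' := fun ha hb x y h hx => ⟨ha x y h hx.1, hb x y h hx.2⟩
      sup_mem' := fun ha hb x y h hx => hx.imp (ha x y h) (hb x y h)
      himp_mem' := by
        intro a b ha hb x y h hx
        rw [ClopenUpperSet.mem_himp_iff] at hx ⊢
        intro y' hy' hya
        obtain ⟨x', hx', h'⟩ := h.symm.forth hy'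
        exact hb x' y' h'.symm (hx x' hx' (ha y' x' h' hya))
      bot_mem' := fun _ _ _ hx => hx
      top_mem' := fun _ _ _ _ => ClopenUpperSet.mem_top }
  exact HeytingSubalgebra.closure_le (L := S) (fun g hg x y h hx => h.mem_of_mem hg hx) hU x y h hx

end Bisimilar

end Bisimulation

/-! ### Counting bisimilarity classes level by level. -/

namespace LadderSpace

open ClopenUpperSet

variable {n : ℕ}

section Levels

variable (G : Finset (LadderAlgebra n))

open Classical in
/-- The elements of `G` that do not contain all points up to level `i`. -/
noncomputable def missing (i : ℕ) : Finset (LadderAlgebra n) :=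
  G.filter fun g => ∃ l j, j ≤ i ∧ pt l j ∉ g

/-- The point `pt l (i + 1)` sees all bisimilarity classes of level `i`. -/
def IsFull (i : ℕ) (l : Fin (2 ^ n + 1)) : Prop :=
  ∀ m : Fin (2 ^ n + 1), ∃ m' : Fin (2 ^ n + 1),
    (m' : ℕ) ≠ l + 1 ∧ Bisimilar (G : Set (LadderAlgebra n)) (pt m i) (pt m' i)

open Classical in
/-- The bisimilarity classes of the points of level `i`. -/
noncomputable def levelClasses (i : ℕ) :
    Finset (Quotient (Bisimilar.setoid (G : Set (LadderAlgebra n)))) :=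
  Finset.univ.image fun l => Quotient.mk _ (pt l i)

variable {G}

theorem mem_missing {i : ℕ} {g : LadderAlgebra n} :
    g ∈ missing G i ↔ g ∈ G ∧ ∃ l j, j ≤ i ∧ pt l j ∉ g := by
  classical
  simp [missing]

theorem missing_subset (i : ℕ) : missing G i ⊆ G := fun _ hg => (mem_missing.1 hg).1

theorem missing_mono {i j : ℕ} (h : i ≤ j) : missing G i ⊆ missing G j := by
  intro g hg
  obtain ⟨hg, l, i', hi', h'⟩ := mem_missing.1 hg
  exact mem_missing.2 ⟨hg, l, i', hi'.trans h, h'⟩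

theorem mem_of_notMem_missing {i j : ℕ} (hj : j ≤ i) {g : LadderAlgebra n} (hg : g ∈ G)
    (h : g ∉ missing G i) (l : Fin (2 ^ n + 1)) : pt l j ∈ g := by
  by_contra h'
  exact h (mem_missing.2 ⟨hg, l, j, hj, h'⟩)

theorem mk_eq_mk_iff {x y : LadderSpace n} :
    (Quotient.mk (Bisimilar.setoid (G : Set (LadderAlgebra n))) x = Quotient.mk _ y) ↔
      Bisimilar (G : Set (LadderAlgebra n)) x y := Quotient.eq

theorem isFull_last (i : ℕ) : IsFull G i (Fin.last _) := fun m =>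
  ⟨m, by have := m.2; rw [Fin.val_last]; omega, Bisimilar.refl _⟩

theorem isFull_of_bisimilar {i : ℕ} {l a b : Fin (2 ^ n + 1)} (ha : (a : ℕ) = l + 1) (hab : a ≠ b)
    (h : Bisimilar (G : Set (LadderAlgebra n)) (pt a i) (pt b i)) : IsFull G i l := by
  intro m
  by_cases hm : m = a
  · subst hm
    exact ⟨b, fun hb => hab (Fin.ext (ha.trans hb.symm)), h⟩
  · exact ⟨m, fun hm' => hm (Fin.ext (hm'.trans ha.symm)), Bisimilar.refl _⟩

/-- Levels above `i` in the order are seen outright, so fullness at level `i` alone yields all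
classes of levels `j ≤ i`. -/
theorem IsFull.exists_ge {i : ℕ} {l : Fin (2 ^ n + 1)} (h : IsFull G i l)
    {m : Fin (2 ^ n + 1)} {j : ℕ} (hj : j ≤ i) :
    ∃ y, pt l (i + 1) ≤ y ∧ Bisimilar (G : Set (LadderAlgebra n)) (pt m j) y := by
  rcases hj.eq_or_lt with rfl | hj
  · obtain ⟨m', hm', hb⟩ := h m
    exact ⟨pt m' j, pt_le_pt_iff.2 (Or.inr (Or.inr ⟨rfl, hm'⟩)), hb⟩
  · exact ⟨pt m j, pt_le_pt_iff.2 (Or.inr (Or.inl (by omega))), Bisimilar.refl _⟩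

theorem exists_of_pt_lt {l : Fin (2 ^ n + 1)} {i : ℕ} {x : LadderSpace n} (h : pt l i < x) :
    ∃ m j, j < i ∧ x = pt m j := by
  cases x with
  | infty => exact absurd h.le not_pt_le_infty
  | pt m j =>
    refine ⟨m, j, ?_, rfl⟩
    rcases Le.level h.le with h' | ⟨rfl, rfl⟩
    · exact h'
    · exact absurd h (lt_irrefl _)

theorem IsFull.bisimilar {i : ℕ} {l l' : Fin (2 ^ n + 1)} (h : IsFull G i l) (h' : IsFull G i l')
    (hc : ∀ g ∈ G, pt l (i + 1) ∈ g ↔ pt l' (i + 1) ∈ g) :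
    Bisimilar (G : Set (LadderAlgebra n)) (pt l (i + 1)) (pt l' (i + 1)) := by
  refine Bisimilar.of_lt hc ?_ ?_
  · intro x hx
    obtain ⟨m, j, hj, rfl⟩ := exists_of_pt_lt hx
    exact h'.exists_ge (by omega)
  · intro x hx
    obtain ⟨m, j, hj, rfl⟩ := exists_of_pt_lt hx
    exact h.exists_ge (by omega)

/-- A full point sees a copy of the omitted point, and `g` is an upset. -/
theorem IsFull.notMem_of_mem_missing {i : ℕ} {l : Fin (2 ^ n + 1)} (h : IsFull G i l)
    {g : LadderAlgebra n} (hg : g ∈ missing G i) : pt l (i + 1) ∉ g := by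
  intro hl
  obtain ⟨hg, m, j, hj, hm⟩ := mem_missing.1 hg
  obtain ⟨y, hy, hb⟩ := h.exists_ge (m := m) hj
  exact hm (hb.symm.mem_of_mem hg (mem_of_le hy hl))

theorem IsFull.mem_iff {i : ℕ} {l : Fin (2 ^ n + 1)} (h : IsFull G i l)
    (hi : missing G i = missing G (i + 1)) {g : LadderAlgebra n} (hg : g ∈ G) :
    pt l (i + 1) ∈ g ↔ g ∉ missing G i :=
  ⟨fun hl hm => h.notMem_of_mem_missing hm hl,
    fun hm => mem_of_notMem_missing le_rfl hg (hi ▸ hm) l⟩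

theorem card_image_le_of_imp {α β γ : Type*} [DecidableEq β] [DecidableEq γ] {s : Finset α}
    {f : α → β} {h : α → γ} {t : Finset γ} (hst : ∀ a ∈ s, h a ∈ t)
    (hfh : ∀ a ∈ s, ∀ b ∈ s, h a = h b → f a = f b) : (s.image f).card ≤ t.card := by
  have key : ∀ b : s.image f, ∃ a ∈ s, f a = b := fun b => Finset.mem_image.1 b.2
  choose r hrs hr using key
  rw [← Fintype.card_coe, ← Fintype.card_coe]
  refine Fintype.card_le_of_injective (fun b => (⟨h (r b), hst _ (hrs b)⟩ : t)) ?_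
  intro b c hbc
  rw [Subtype.ext_iff, ← hr b, ← hr c]
  exact hfh _ (hrs b) _ (hrs c) (congrArg Subtype.val hbc)

theorem exists_ne_bisimilar_of_card {i : ℕ} (h : (levelClasses G i).card ≤ 2 ^ n) :
    ∃ a b : Fin (2 ^ n + 1), a < b ∧ Bisimilar (G : Set (LadderAlgebra n)) (pt a i) (pt b i) := by
  classical
  obtain ⟨a, -, b, -, hab, he⟩ := Finset.exists_ne_map_eq_of_card_lt_of_maps_to
    (s := (Finset.univ : Finset (Fin (2 ^ n + 1)))) (t := levelClasses G i)
    (f := fun l => Quotient.mk _ (pt l i)) (by rw [Finset.card_univ, Fintype.card_fin]; omega)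
    (fun l _ => Finset.mem_coe.2 (Finset.mem_image_of_mem _ (Finset.mem_univ l)))
  have he' := mk_eq_mk_iff.1 he
  rcases lt_or_gt_of_ne hab with h | h
  · exact ⟨a, b, h, he'⟩
  · exact ⟨b, a, h, he'.symm⟩

/-- For maximal points bisimilarity is equality of colour, and generators outside `missing G 0` do
not distinguish them. -/
theorem card_levelClasses_zero : (levelClasses G 0).card ≤ 2 ^ (missing G 0).card := by
  classical
  rw [← Finset.card_powerset]
  refine card_image_le_of_imp (h := fun l => (missing G 0).filter fun g => pt l 0 ∈ g)
    (fun l _ => Finset.mem_powerset.2 (Finset.filter_subset _ _)) ?_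
  intro l _ m _ hlm
  refine mk_eq_mk_iff.2 (Bisimilar.of_lt ?_ ?_ ?_)
  · intro g hg
    by_cases hg' : g ∈ missing G 0
    · have := Finset.ext_iff.1 hlm g
      simpa [hg'] using this
    · exact iff_of_true (mem_of_notMem_missing le_rfl hg hg' l)
        (mem_of_notMem_missing le_rfl hg hg' m)
  all_goals
    intro x hx
    obtain ⟨_, j, hj, -⟩ := exists_of_pt_lt hx
    omega

open Classical in
-- The class of a full point depends only on its colour under the newly missing generators. Non-full
-- points inject into the singleton classes of level `i`, and the class of `a` and `b` is not one of
-- these, which saves `1`.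
theorem card_levelClasses_succ {i : ℕ} {a b : Fin (2 ^ n + 1)} (hab : a ≠ b)
    (h : Bisimilar (G : Set (LadderAlgebra n)) (pt a i) (pt b i)) :
    (levelClasses G (i + 1)).card + 1 ≤
      2 ^ (missing G (i + 1) \ missing G i).card + (levelClasses G i).card := by
  classical
  have hsplit : levelClasses G (i + 1) =
      ((Finset.univ.filter (IsFull G i)).image fun l => Quotient.mk _ (pt l (i + 1))) ∪
        ((Finset.univ.filter fun l => ¬ IsFull G i l).image
          fun l => Quotient.mk _ (pt l (i + 1))) := by
    rw [← Finset.image_union, Finset.filter_union_filter_not_eq]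
    rfl
  have h1 : ((Finset.univ.filter (IsFull G i)).image fun l => Quotient.mk
      (Bisimilar.setoid (G : Set (LadderAlgebra n))) (pt l (i + 1))).card ≤
      2 ^ (missing G (i + 1) \ missing G i).card := by
    rw [← Finset.card_powerset]
    refine card_image_le_of_imp
      (h := fun l => (missing G (i + 1) \ missing G i).filter fun g => pt l (i + 1) ∈ g)
      (fun l _ => Finset.mem_powerset.2 (Finset.filter_subset _ _)) ?_
    intro l hl m hm hlm
    have hl := (Finset.mem_filter.1 hl).2
    have hm := (Finset.mem_filter.1 hm).2
    refine mk_eq_mk_iff.2 (hl.bisimilar hm fun g hg => ?_)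
    by_cases h0 : g ∈ missing G i
    · exact iff_of_false (hl.notMem_of_mem_missing h0) (hm.notMem_of_mem_missing h0)
    by_cases h1 : g ∈ missing G (i + 1)
    · have := Finset.ext_iff.1 hlm g
      simpa [h0, h1] using this
    · exact iff_of_true (mem_of_notMem_missing le_rfl hg h1 l)
        (mem_of_notMem_missing le_rfl hg h1 m)
  -- Fullness fails only when the one unseen point `l + 1` has no twin on level `i`.
  have hnf : ∀ l : Fin (2 ^ n + 1), ¬ IsFull G i l → ∃ p : Fin (2 ^ n + 1), (p : ℕ) = l + 1 ∧
      ∀ q, q ≠ p → ¬ Bisimilar (G : Set (LadderAlgebra n)) (pt p i) (pt q i) := by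
    intro l hl
    simp only [IsFull, not_forall, not_exists, not_and] at hl
    obtain ⟨p, hp⟩ := hl
    have hp' : (p : ℕ) = l + 1 := by
      by_contra h'
      exact hp p h' (Bisimilar.refl _)
    exact ⟨p, hp', fun q hq => hp q fun hq' => hq (Fin.ext (hq'.trans hp'.symm))⟩
  choose! p hp hpq using hnf
  have h2 : (Finset.univ.filter fun l => ¬ IsFull G i l).card + 1 ≤ (levelClasses G i).card := by
    have hb : Quotient.mk _ (pt b i) ∈ levelClasses G i :=
      Finset.mem_image_of_mem _ (Finset.mem_univ b)
    rw [← Finset.card_erase_add_one hb]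
    refine Nat.succ_le_succ (Finset.card_le_card_of_injOn
      (fun l => Quotient.mk _ (pt (p l) i)) ?_ ?_)
    · intro l hl
      have hl := (Finset.mem_filter.1 hl).2
      refine Finset.mem_erase.2 ⟨fun he => ?_, Finset.mem_image_of_mem _ (Finset.mem_univ _)⟩
      have he' := mk_eq_mk_iff.1 he
      by_cases hbp : b = p l
      · exact hpq l hl a (hbp ▸ hab) (hbp ▸ h.symm)
      · exact hpq l hl b hbp he'
    · intro l hl m hm he
      have hl := (Finset.mem_filter.1 hl).2
      have hm := (Finset.mem_filter.1 hm).2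
      have he' := mk_eq_mk_iff.1 he
      by_cases hml : p m = p l
      · have h1 := hp l hl
        have h2 := hp m hm
        rw [hml] at h2
        exact Fin.ext (by omega)
      · exact absurd he' (hpq l hl _ hml)
  have h3 : ((Finset.univ.filter fun l => ¬ IsFull G i l).image fun l => Quotient.mk
      (Bisimilar.setoid (G : Set (LadderAlgebra n))) (pt l (i + 1))).card ≤ _ :=
    Finset.card_image_le
  have h4 := Finset.card_union_le
    ((Finset.univ.filter (IsFull G i)).image fun l => Quotient.mk
      (Bisimilar.setoid (G : Set (LadderAlgebra n))) (pt l (i + 1)))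
    ((Finset.univ.filter fun l => ¬ IsFull G i l).image
          fun l => Quotient.mk _ (pt l (i + 1)))
  rw [← hsplit] at h4
  omega

/-- The bound for level `i` is at most `2 ^ n`, so two of its `2 ^ n + 1` points are bisimilar,
which is what the step to level `i + 1` needs. -/
theorem card_levelClasses_le (hG : G.card ≤ n) (i : ℕ) :
    (levelClasses G i).card ≤ 2 ^ (missing G i).card := by
  classical
  induction i with
  | zero => exact card_levelClasses_zero
  | succ i ih =>
    obtain ⟨a, b, hab, h⟩ := exists_ne_bisimilar_of_card (ih.trans (Nat.pow_le_pow_right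
      (by norm_num) ((Finset.card_le_card (missing_subset i)).trans hG)))
    have h1 := card_levelClasses_succ hab.ne h
    have h2 := Finset.card_sdiff_add_card_eq_card (missing_mono (G := G) (Nat.le_succ i))
    rw [Nat.succ_eq_add_one] at h2
    rw [← h2, pow_add]
    have h3 := Nat.one_le_two_pow (n := (missing G (i + 1) \ missing G i).card)
    have h4 := Nat.one_le_two_pow (n := (missing G i).card)
    obtain ⟨x, hx⟩ := Nat.exists_eq_add_of_le h3
    obtain ⟨y, hy⟩ := Nat.exists_eq_add_of_le h4
    rw [hx] at h1 ⊢
    rw [hy] at ih ⊢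
    -- With the two powers written `1 + x` and `1 + y`, this is `1 + x + y ≤ (1 + x) * (1 + y)`.
    nlinarith [Nat.zero_le (x * y)]

theorem exists_lt_bisimilar (hG : G.card ≤ n) (i : ℕ) :
    ∃ a b : Fin (2 ^ n + 1), a < b ∧ Bisimilar (G : Set (LadderAlgebra n)) (pt a i) (pt b i) :=
  exists_ne_bisimilar_of_card ((card_levelClasses_le hG i).trans (Nat.pow_le_pow_right
      (by norm_num) ((Finset.card_le_card (missing_subset i)).trans hG)))

theorem missing_eq_of_le_of_le {i j j' k : ℕ} (h : missing G i = missing G k) (hi : i ≤ j)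
    (hj : j ≤ j') (hk : j' ≤ k) : missing G j = missing G j' :=
  (missing_mono hj).antisymm
    ((missing_mono hk).trans (h.symm.subset.trans (missing_mono hi)))

theorem IsFull.bisimilar_of_missing_eq {i : ℕ} {l l' : Fin (2 ^ n + 1)} (h : IsFull G i l)
    (h' : IsFull G i l') (hi : missing G i = missing G (i + 1)) :
    Bisimilar (G : Set (LadderAlgebra n)) (pt l (i + 1)) (pt l' (i + 1)) :=
  h.bisimilar h' fun _ hg => (h.mem_iff hi hg).trans (h'.mem_iff hi hg).symm

/-- While no further generator is missed, the number of full points increases from level to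
level. -/
theorem isFull_of_missing_eq (hG : G.card ≤ n) {i : ℕ} (s : ℕ)
    (hs : missing G i = missing G (i + s + 1)) (l : Fin (2 ^ n + 1)) (hl : 2 ^ n ≤ l + s + 1) :
    IsFull G (i + s + 1) l := by
  induction s generalizing l with
  | zero =>
    by_cases hlast : l = Fin.last _
    · exact hlast ▸ isFull_last _
    have hl' := l.2
    rw [Fin.ext_iff, Fin.val_last] at hlast
    obtain ⟨a, b, hab, h⟩ := exists_lt_bisimilar hG i
    have hab' : (a : ℕ) < b := hab
    have hb2 := b.2
    -- The predecessor of `b` misses only `b`, which has the twin `a`; `a < b` makes the predecessor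
    -- exist. One level down it is then a twin of the last point.
    have hfb : IsFull G i ⟨b - 1, by omega⟩ :=
      isFull_of_bisimilar (a := b) (b := a) (by simp only; omega) hab.ne' h.symm
    refine isFull_of_bisimilar (a := Fin.last _) (b := ⟨b - 1, by omega⟩)
      (by rw [Fin.val_last]; omega) ?_ ((isFull_last i).bisimilar_of_missing_eq hfb hs)
    rw [ne_eq, Fin.ext_iff, Fin.val_last]
    simp only
    omega
  | succ s ih =>
    have ih := ih (missing_eq_of_le_of_le hs le_rfl (by omega) (by omega))
    by_cases hlast : l = Fin.last _
    · exact hlast ▸ isFull_last _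
    have hl' := l.2
    rw [Fin.ext_iff, Fin.val_last] at hlast
    have hm : missing G (i + s + 1) = missing G (i + s + 1 + 1) :=
      missing_eq_of_le_of_le hs (by omega) (by omega) (by omega)
    have hf := ih ⟨l + 1, by omega⟩ (by simp only; omega)
    -- The twin of `l + 1` is the last point, unless `l + 1` is itself last; then `l`, already full,
    -- serves.
    by_cases hl2 : (l : ℕ) + 1 = 2 ^ n
    · refine isFull_of_bisimilar (a := ⟨l + 1, by omega⟩) (b := l) rfl ?_
        (hf.bisimilar_of_missing_eq (ih l (by omega)) hm)
      rw [ne_eq, Fin.ext_iff]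
      simp
    · refine isFull_of_bisimilar (a := ⟨l + 1, by omega⟩) (b := Fin.last _) rfl ?_
        (hf.bisimilar_of_missing_eq (isFull_last _) hm)
      rw [ne_eq, Fin.ext_iff, Fin.val_last]
      exact hl2

theorem isFull_of_missing_eq_add (hG : G.card ≤ n) {i k : ℕ} (hk : 2 ^ n ≤ k)
    (h : missing G i = missing G (i + k)) (l : Fin (2 ^ n + 1)) : IsFull G (i + k) l := by
  have hpos := Nat.two_pow_pos n
  obtain ⟨s, rfl⟩ := Nat.exists_eq_add_of_le' (show 1 ≤ k by omega)
  exact isFull_of_missing_eq hG s h l (by omega)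

/-- All points of both levels are full and carry the same colour. What the lower point sees on the
upper level is bisimilar to the upper point itself. -/
theorem bisimilar_of_missing_eq (hG : G.card ≤ n) {i : ℕ}
    (h : missing G i = missing G (i + (2 ^ n + 2))) (l l' : Fin (2 ^ n + 1)) :
    Bisimilar (G : Set (LadderAlgebra n)) (pt l (i + (2 ^ n + 2))) (pt l' (i + (2 ^ n + 1))) := by
  have hm : ∀ k, k ≤ 2 ^ n + 2 → missing G i = missing G (i + k) := fun k hk =>
    missing_eq_of_le_of_le h le_rfl (by omega) (by omega)
  have e0 : missing G i = missing G (i + 2 ^ n) := hm _ (by omega)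
  have e1 : missing G i = missing G (i + (2 ^ n + 1)) := hm _ (by omega)
  have h1 : ∀ m, IsFull G (i + 2 ^ n) m := isFull_of_missing_eq_add hG le_rfl e0
  have h2 : IsFull G (i + (2 ^ n + 1)) l := isFull_of_missing_eq_add hG (Nat.le_succ _) e1 l
  refine Bisimilar.of_lt (fun g hg => ?_) ?_ ?_
  · refine (h2.mem_iff (e1.symm.trans h) hg).trans
      (Iff.trans ?_ ((h1 l').mem_iff (e0.symm.trans e1) hg).symm)
    rw [← e0, ← e1]
  · intro x hx
    obtain ⟨m, j, hj, rfl⟩ := exists_of_pt_lt hx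
    rcases Nat.lt_or_ge j (i + (2 ^ n + 1)) with hj' | hj'
    · exact (h1 l').exists_ge (by omega)
    · obtain rfl : j = i + (2 ^ n + 1) := by omega
      exact ⟨_, le_rfl, (h1 m).bisimilar_of_missing_eq (h1 l') (e0.symm.trans e1)⟩
  · intro x hx
    obtain ⟨m, j, hj, rfl⟩ := exists_of_pt_lt hx
    exact h2.exists_ge (by omega)

/-- The first level containing a point outside `g` (and `0` if there is none). -/
noncomputable def firstMissing (g : LadderAlgebra n) : ℕ := sInf {i | ∃ l, pt l i ∉ g}

theorem firstMissing_le {i : ℕ} {g : LadderAlgebra n} (h : g ∈ missing G i) :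
    firstMissing g ≤ i := by
  obtain ⟨-, l, j, hj, h⟩ := mem_missing.1 h
  exact (Nat.sInf_le (show j ∈ {i | ∃ l, pt l i ∉ g} from ⟨l, h⟩)).trans hj

theorem mem_missing_firstMissing {i : ℕ} {g : LadderAlgebra n} (h : g ∈ missing G i) :
    g ∈ missing G (firstMissing g) := by
  obtain ⟨hg, l, j, hj, h⟩ := mem_missing.1 h
  obtain ⟨l', h'⟩ := Nat.sInf_mem (s := {i | ∃ l, pt l i ∉ g}) ⟨j, l, h⟩
  exact mem_missing.2 ⟨hg, l', _, le_rfl, h'⟩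

open Classical in
variable (G) in
/-- The levels shortly after `0` or after a level where an element of `G` stops being full. -/
noncomputable def transientLevels : Finset ℕ :=
  Finset.range (2 ^ n + 2) ∪
    G.biUnion fun g => Finset.Ico (firstMissing g) (firstMissing g + (2 ^ n + 2))

theorem card_transientLevels_le (hG : G.card ≤ n) :
    (transientLevels G).card ≤ (2 ^ n + 2) + n * (2 ^ n + 2) := by
  classical
  refine (Finset.card_union_le _ _).trans (Nat.add_le_add (by rw [Finset.card_range]) ?_)
  refine (Finset.card_biUnion_le_card_mul _ _ (2 ^ n + 2) fun g _ => ?_).trans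
    (Nat.mul_le_mul_right _ hG)
  rw [Nat.card_Ico, Nat.add_sub_cancel_left]

/-- At a non-transient level no generator was lost during the last `2 ^ n + 2` levels, so its points
are bisimilar to points one level up; iterate. -/
theorem exists_transient_bisimilar (hG : G.card ≤ n) (j : ℕ) (l : Fin (2 ^ n + 1)) :
    ∃ m, ∃ i ∈ transientLevels G,
      Bisimilar (G : Set (LadderAlgebra n)) (pt l j) (pt m i) := by
  classical
  induction j with
  | zero => exact ⟨l, 0, Finset.mem_union_left _ (by simp), Bisimilar.refl _⟩
  | succ j ih =>
    by_cases hj : j + 1 ∈ transientLevels G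
    · exact ⟨l, j + 1, hj, Bisimilar.refl _⟩
    simp only [transientLevels, Finset.mem_union, Finset.mem_range, not_or, Finset.mem_biUnion,
      not_exists, not_and, Finset.mem_Ico, not_lt] at hj
    obtain ⟨i, hi⟩ := Nat.exists_eq_add_of_le' hj.1
    obtain rfl : j = i + (2 ^ n + 1) := by omega
    have hm : missing G i = missing G (i + (2 ^ n + 2)) := by
      refine (missing_mono (Nat.le_add_right _ _)).antisymm fun g hg => ?_
      have h1 := firstMissing_le hg
      have h2 := hj.2 g (missing_subset _ hg) (by omega)
      exact missing_mono (by omega) (mem_missing_firstMissing hg)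
    obtain ⟨m, i', hi', h⟩ := ih
    exact ⟨m, i', hi', (bisimilar_of_missing_eq hG hm l l).trans h⟩

theorem infty_mem_iff {g : LadderAlgebra n} : infty ∈ g ↔ ∀ l i, pt l i ∈ g := by
  refine ⟨fun h _ _ => mem_of_infty_mem h _, fun h => ?_⟩
  by_contra hg
  exact Set.infinite_of_injective_forall_mem (f := fun i => (pt 0 i : LadderSpace n))
    (fun a b hab => by simpa using hab) (h 0) (finite_of_infty_notMem hg)

/-- Past the last loss of a generator, all sufficiently deep levels form a single class, and a point
there sees every class and has the colour of `infty`. -/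
theorem exists_bisimilar_infty (hG : G.card ≤ n) :
    ∃ i l, Bisimilar (G : Set (LadderAlgebra n)) infty (pt l i) := by
  set i := G.sup firstMissing with hi
  have hm : ∀ k, missing G i = missing G (i + k) := fun k => by
    refine (missing_mono (by omega)).antisymm fun g hg => ?_
    exact missing_mono (Finset.le_sup (missing_subset _ hg)) (mem_missing_firstMissing hg)
  have hk : ∀ k, ∀ l l', Bisimilar (G : Set (LadderAlgebra n)) (pt l (i + (2 ^ n + 1 + k)))
      (pt l' (i + (2 ^ n + 1))) := by
    intro k
    induction k with
    | zero =>
      intro l l'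
      exact (isFull_of_missing_eq_add hG le_rfl (hm _) l).bisimilar_of_missing_eq
        (isFull_of_missing_eq_add hG le_rfl (hm _) l') ((hm _).symm.trans (hm (2 ^ n + 1)))
    | succ k ih =>
      intro l l'
      have := bisimilar_of_missing_eq hG (i := i + k)
        ((hm _).symm.trans ((hm _).trans (by rw [add_assoc]))) l l
      rw [show i + k + (2 ^ n + 2) = i + (2 ^ n + 1 + (k + 1)) by omega,
        show i + k + (2 ^ n + 1) = i + (2 ^ n + 1 + k) by omega] at this
      exact this.trans (ih l l')
  have h0 : IsFull G (i + 2 ^ n) (0 : Fin (2 ^ n + 1)) :=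
    isFull_of_missing_eq_add hG le_rfl (hm _) 0
  refine ⟨i + (2 ^ n + 1), 0, Bisimilar.of_lt ?_ ?_ fun y _ => ⟨y, infty_le y, Bisimilar.refl _⟩⟩
  · intro g hg
    refine ⟨fun h => mem_of_infty_mem h _, fun h => infty_mem_iff.2 fun l j => ?_⟩
    have h1 := (h0.mem_iff ((hm _).symm.trans (hm (2 ^ n + 1))) hg).1 h
    rw [← hm, hm j] at h1
    exact mem_of_notMem_missing (by omega) hg h1 l
  · intro x hx
    cases x with
    | infty => exact absurd hx (lt_irrefl _)
    | pt l j =>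
      rcases Nat.lt_or_ge j (i + (2 ^ n + 1)) with hj | hj
      · exact h0.exists_ge (by omega)
      · obtain ⟨k, rfl⟩ := Nat.exists_eq_add_of_le hj
        rw [add_assoc]
        exact ⟨_, le_rfl, hk k l 0⟩

theorem exists_transient_bisimilar' (hG : G.card ≤ n) (x : LadderSpace n) :
    ∃ m, ∃ i ∈ transientLevels G, Bisimilar (G : Set (LadderAlgebra n)) x (pt m i) := by
  cases x with
  | pt l j => exact exists_transient_bisimilar hG j l
  | infty =>
    obtain ⟨j, l, h⟩ := exists_bisimilar_infty hG
    obtain ⟨m, i, hi, h'⟩ := exists_transient_bisimilar hG j l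
    exact ⟨m, i, hi, h.trans h'⟩

end Levels

/-! ### Embedding in a finite powerset, and isomorphism types. -/

theorem exists_orderEmbedding {L : HeytingSubalgebra (LadderAlgebra n)} (hL : L.IsGenerated n) :
    Nonempty (L ↪o Set (Fin (2 ^ n + 1) × Fin ((2 ^ n + 2) + n * (2 ^ n + 2)))) := by
  obtain ⟨G, hG, rfl⟩ := hL
  obtain ⟨G, rfl⟩ := (Set.finite_of_encard_le_coe hG).exists_finset_coe
  have hG : G.card ≤ n := by simpa using hG
  -- Padding to the exact bound makes the codomain independent of `G`.
  obtain ⟨T, hT, hc⟩ := Infinite.exists_superset_card_eq _ _ (card_transientLevels_le hG)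
  refine ⟨OrderEmbedding.ofMapLEIff
    (fun U => {p | pt p.1 (T.orderEmbOfFin hc p.2) ∈ U.1}) fun U V => ?_⟩
  refine ⟨fun h x hx => ?_, fun h p hp => h hp⟩
  obtain ⟨m, i, hi, hb⟩ := exists_transient_bisimilar' hG x
  obtain ⟨t, rfl⟩ : i ∈ Set.range (T.orderEmbOfFin hc) := by
    rw [Finset.range_orderEmbOfFin]
    exact hT hi
  exact hb.symm.mem_of_mem_closure V.2
    (h (a := (m, t)) (hb.mem_of_mem_closure U.2 hx))

theorem finite_of_isGenerated {L : HeytingSubalgebra (LadderAlgebra n)} (hL : L.IsGenerated n) :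
    Finite L :=
  (exists_orderEmbedding hL).elim fun e => Finite.of_injective e e.injective


end LadderSpace

namespace HeytingSubalgebra

variable {A : Type*} [HeytingAlgebra A]

/-- The Heyting operations are determined by the order. -/
theorem isIsomorphic_of_orderIso {L M : HeytingSubalgebra A} (e : L ≃o M) : L.IsIsomorphic M :=
  ⟨(e : HeytingHom L M), e.bijective⟩

/-- Subalgebras that embed, as ordered sets, in a fixed finite ordered set fall into finitely many
isomorphism classes. -/
theorem exists_finite_representatives {P : Type*} [PartialOrder P] [Finite P]
    (S : Set (HeytingSubalgebra A)) (hS : ∀ L ∈ S, Nonempty (L ↪o P)) :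
    ∃ F ⊆ S, F.Finite ∧ ∀ L ∈ S, ∃ M ∈ F, L.IsIsomorphic M := by
  classical
  let code : HeytingSubalgebra A → Set P := fun L =>
    if h : Nonempty (L ↪o P) then Set.range h.some else ∅
  -- One representative per image in `P`; subalgebras with the same image are order isomorphic, and
  -- `P` has finitely many subsets.
  obtain ⟨F, hFS, hF⟩ := Set.exists_subset_bijOn S code
  refine ⟨F, hFS, Set.Finite.of_finite_image (Set.toFinite _) hF.injOn, fun L hL => ?_⟩
  obtain ⟨M, hM, hML⟩ := hF.surjOn ⟨L, hL, rfl⟩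
  refine ⟨M, hM, ?_⟩
  have h1 := hS L hL
  have h2 := hS M (hFS hM)
  simp only [code, dif_pos h1, dif_pos h2] at hML
  exact isIsomorphic_of_orderIso (h1.some.orderIso.trans
    ((OrderIso.setCongr _ _ hML.symm).trans h2.some.orderIso.symm))

end HeytingSubalgebra

theorem mainTheorem4 (k : ℕ) :
    IsKGenerated (LadderAlgebra k) (k + 1) ∧
    (¬ ∃ L : HeytingSubalgebra (LadderAlgebra k), L.IsGenerated k ∧ Infinite L) ∧
    (∃ F : Set (HeytingSubalgebra (LadderAlgebra k)), F.Finite ∧ (∀ M ∈ F, M.IsGenerated k) ∧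
      ∀ L : HeytingSubalgebra (LadderAlgebra k), L.IsGenerated k → ∃ M ∈ F, L.IsIsomorphic M) ∧
    IsStrictlyKGenerated (LadderAlgebra k) (k + 1) := by
  refine ⟨LadderSpace.isKGenerated_ladderAlgebra k, ?_, ?_, LadderSpace.infinite_ladderAlgebra k,
    LadderSpace.isKGenerated_ladderAlgebra k, ?_⟩
  · rintro ⟨L, hL, hinf⟩
    exact hinf.not_finite (LadderSpace.finite_of_isGenerated hL)
  · obtain ⟨F, hFS, hF, h⟩ := HeytingSubalgebra.exists_finite_representatives
      {L : HeytingSubalgebra (LadderAlgebra k) | L.IsGenerated k}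
      fun L hL => LadderSpace.exists_orderEmbedding hL
    exact ⟨F, hF, fun M hM => hFS hM, h⟩
  · intro G hG
    have := LadderSpace.finite_of_isGenerated (L := HeytingSubalgebra.closure G) ⟨G, hG, rfl⟩
    exact Set.toFinite _
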